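/- Let $\mathcal S_{sk}$ be the category with objects the finite ordinals $I=\{1<\dots<n\}$, $n\ge 0$, and all maps as morphisms; a fibre $\phi^{-1}j$ of a map, with the induced order, is identified with an ordinal by its unique increasing enumeration, so that families indexed by it are again families indexed by an object of $\mathcal S_{sk}$. Composites of maps are written from left to right. A symmetric weak multicategory $\mathbf V$ consists of: objects; a category $\mathbf V((X_i)_{i\in I};Y)$ for every family $(X_i)_{i\in I}$, $I\in\mathcal S_{sk}$, of objects and every object $Y$; for every map $\phi:I\to J$ in $\mathcal S_{sk}$ a composition functor $$\mu_\phi:\Big[\prod_{j\in J}\mathbf V((X_i)_{i\in\phi^{-1}j};Y_j)\Big]\times\mathbf V((Y_j)_{j\in J};Z)\to\mathbf V((X_i)_{i\in I};Z);$$ identities $1_X\in\mathbf V(X;X)$; and natural isomorphisms $$\nu_{\phi,\psi}:\mu_{\phi\psi}\big((\mu_{\phi_k}((f_j)_{j\in\psi^{-1}k},g_k))_{k\in K},h\big)\to\mu_\phi\big((f_j)_{j\in J},\mu_\psi((g_k)_{k\in K},h)\big)$$ for $I\xrightarrow{\phi}J\xrightarrow{\psi}K$, where $\phi_k:(\phi\psi)^{-1}k\to\psi^{-1}k$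 is the restriction of $\phi$; $\zeta_I:\mu_{I\to\mathbf 1}(f,1_Z)\to f$; and $\theta_I:\mu_{\mathrm{id}_I}((1_{X_i})_{i\in I},f)\to f$. They satisfy two axioms. (i) For $I\xrightarrow{\phi}J\xrightarrow{\psi}K\xrightarrow{\xi}L$, the two transformations $$\mu_{\phi\psi\xi}\big((\mu_{(\phi\psi)_l}((\mu_{\phi_k}((f_j)_{j\in\psi^{-1}k},g_k))_{k\in\xi^{-1}l},h_l))_{l\in L},u\big)\to\mu_\phi\big((f_j)_j,\mu_\psi((g_k)_k,\mu_\xi((h_l)_l,u))\big),$$ namely $\nu_{\phi\psi,\xi}$ followed by $\nu_{\phi,\psi}$, and $\mu_{\phi\psi\xi}((\nu_{\phi_l,\psi_l})_{l\in L},1)$ followed by $\nu_{\phi,\psi\xi}$ and $\mu_\phi(1,\nu_{\psi,\xi})$, coincide. (ii) For $\phi:I\to J$, $\nu_{\phi,\mathrm{id}_J}$ at $((f_j)_j,(1_{Y_j})_j,g)$ followed by $\mu_\phi((f_j)_j,\theta_J)$ equals $\mu_\phi((\zeta_{\phi^{-1}j})_{j\in J},1_g)$. For a bijection $\alpha:I\to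 J$ in $\mathcal S_{sk}$ and families of objects with $X_i=Y_{\alpha i}$ let $$r_\alpha:\mathbf V((Y_j)_{j\in J};U)\to\mathbf V((X_i)_{i\in I};U),\qquad r_\alpha(g)=\mu_\alpha((1_{Y_j})_{j\in J},g).$$ For bijections $I\xrightarrow{\alpha}J\xrightarrow{\beta}K$ and families with $X_i=Y_{\alpha i}$, $Y_j=Z_{\beta j}$ let $\varphi_{\alpha,\beta}:r_{\alpha\beta}\to r_\alpha\circ r_\beta$ be the natural isomorphism whose component at $g$ is $$\mu_{\alpha\beta}((1_{Z_k})_k,g)\xrightarrow{\mu_{\alpha\beta}((\theta_{\mathbf 1}^{-1})_k,1)}\mu_{\alpha\beta}\big((\mu_{\mathbf 1\to\mathbf 1}(1_{Y_{\beta^{-1}k}},1_{Z_k}))_k,g\big)\xrightarrow{\nu_{\alpha,\beta}}\mu_\alpha\big((1_{Y_j})_j,\mu_\beta((1_{Z_k})_k,g)\big).$$ Proposition. Let $\mathbf V$ be a symmetric weak multicategory. (a) Let $I\xrightarrow{\alpha}J\xrightarrow{\beta}K\xrightarrow{\gamma}L$ be bijections in $\mathcal S_{sk}$, and let $(X_i)_{i\in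 I}$, $(Y_j)_{j\in J}$, $(Z_k)_{k\in K}$, $(W_l)_{l\in L}$, $U$ be (families of) objects of $\mathbf V$ with $X_i=Y_{\alpha i}$, $Y_j=Z_{\beta j}$, $Z_k=W_{\gamma k}$ for all $i,j,k$. Then the non-abelian cocycle identity holds: the transformations $$r_{\alpha\beta\gamma}\xrightarrow{\varphi_{\alpha,\beta\gamma}}r_\alpha r_{\beta\gamma}\xrightarrow{r_\alpha(\varphi_{\beta,\gamma})}r_\alpha r_\beta r_\gamma\quad\text{and}\quad r_{\alpha\beta\gamma}\xrightarrow{\varphi_{\alpha\beta,\gamma}}r_{\alpha\beta}r_\gamma\xrightarrow{\varphi_{\alpha,\beta}r_\gamma}r_\alpha r_\beta r_\gamma$$ of functors $\mathbf V((W_l)_{l\in L};U)\to\mathbf V((X_i)_{i\in I};U)$ are equal. (b) Consequently, for every $n\ge 0$ and every object $U$, the symmetric group $S_n$ acts weakly on the collection of categories $\mathbf V((X_i)_{i\le n};U)$, where $(X_i)_{i\le n}$ runs over all families of $n$ objects and a permutation $\sigma$ takes $(X_i)_i$ to $(X_{\sigma i})_i$: the functors $r_\sigma$, the isomorphisms $\varphi$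 and the isomorphisms $\theta_I:r_{\mathrm{id}_I}\to\mathrm{Id}$ satisfy the cocycle identity, and both composites $r_\sigma\xrightarrow{\varphi_{\sigma,\mathrm{id}}}r_\sigma r_{\mathrm{id}}\xrightarrow{r_\sigma(\theta)}r_\sigma$ and $r_\sigma\xrightarrow{\varphi_{\mathrm{id},\sigma}}r_{\mathrm{id}}r_\sigma\xrightarrow{\theta\, r_\sigma}r_\sigma$ are identities. -/

import Mathlib

open CategoryTheory

set_option linter.checkUnivs false

universe u v w

/-!
## Families indexed by objects and fibres of the skeletal category of finite ordinals

An object of the skeleton of finite totally ordered sets is a number `n`, seen as `Fin n`; morphisms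
are all maps `Fin m → Fin n`.  A family of objects indexed by such an ordinal is a list.  A fibre
`φ⁻¹ j` of a map `φ`, with the induced order, is identified with an ordinal by its unique
increasing enumeration.
-/

/-- The family `(X i)` indexed by `i ∈ φ⁻¹ j`, in increasing order of `i`. -/
def fibreFamily {Ob : Type u} {m n : ℕ} (φ : Fin m → Fin n) (X : Fin m → Ob) (j : Fin n) :
    List Ob :=
  ((List.finRange m).filter (fun i => φ i = j)).map X

/-- `e j : Fin (a j) → Fin m` is the increasing enumeration of `φ⁻¹ j`, for every `j`
(so `a` and `e` are determined by `φ`). -/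
structure IsFibreEnum {m n : ℕ} (φ : Fin m → Fin n) (a : Fin n → ℕ)
    (e : ∀ j, Fin (a j) → Fin m) : Prop where
  strictMono : ∀ j, StrictMono (e j)
  mem_iff : ∀ j i, φ i = j ↔ ∃ s, e j s = i

/-- The sources and targets fit for composition along `φ : I → J`: there are families
`(X i)_{i ∈ I}` and `(Y j)_{j ∈ J}` such that `x = (X i)_{i ∈ I}`, `S j = (X i)_{i ∈ φ⁻¹ j}`,
`T j = Y j` and `y = (Y j)_{j ∈ J}`.  Then morphisms `S j → T j`, `j ∈ J`, and a morphism `y → z`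
have a composite `x → z`.  (Sources and targets are matched by propositional equations, which
avoids transporting morphisms along equalities of objects.) -/
def Composable {Ob : Type u} {m n : ℕ} (φ : Fin m → Fin n) (S : Fin n → List Ob)
    (T : Fin n → Ob) (x y : List Ob) : Prop :=
  (∃ X : Fin m → Ob, x = List.ofFn X ∧ ∀ j, S j = fibreFamily φ X j) ∧ y = List.ofFn T

/-- The situation in which the associator is defined: `I --φ--> J --ψ--> K` with composite `χ`,
families `x = (X i)_{i ∈ I}`, `y = (Y j)_{j ∈ J}`, `z = (Z k)_{k ∈ K}`, where
* `e k` enumerates `ψ⁻¹ k` and `d k` enumerates `χ⁻¹ k`,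
* `φr k : χ⁻¹ k → ψ⁻¹ k` is the restriction of `φ`,
* `S j = (X i)_{i ∈ φ⁻¹ j}`, `T j = Y j`,
* `S' k = (Y j)_{j ∈ ψ⁻¹ k}`, `T' k = Z k`,
* `R k = (X i)_{i ∈ χ⁻¹ k}`.
The last field follows from the others. -/
structure AssocShape {Ob : Type u} {m n p : ℕ} (φ : Fin m → Fin n) (ψ : Fin n → Fin p)
    (χ : Fin m → Fin p) (b : Fin p → ℕ) (e : ∀ k, Fin (b k) → Fin n) (c : Fin p → ℕ)
    (d : ∀ k, Fin (c k) → Fin m) (φr : ∀ k, Fin (c k) → Fin (b k))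
    (S : Fin n → List Ob) (T : Fin n → Ob) (S' : Fin p → List Ob) (T' : Fin p → Ob)
    (R : Fin p → List Ob) (x y z : List Ob) : Prop where
  comp_eq : ∀ i, χ i = ψ (φ i)
  enum_snd : IsFibreEnum ψ b e
  enum_comp : IsFibreEnum χ c d
  restrict : ∀ k s, e k (φr k s) = φ (d k s)
  fst : Composable φ S T x y
  snd : Composable ψ S' T' y z
  whole : Composable χ R T' x z
  part : ∀ k, Composable (φr k) (fun s => S (e k s)) (fun s => T (e k s)) (R k) (S' k)

/-- The situation of the associativity equation: `I --φ--> J --ψ--> K --ξ--> L`, with composites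
`χ = φψ`, `ρ = ψξ`, `τ = φψξ` (read from left to right), families `x, y, z, t` indexed by
`I, J, K, L`, enumerations of the fibres of `ψ, χ, ξ, ρ, τ` and of the fibres of the restrictions
`ψL l : ρ⁻¹ l → ξ⁻¹ l` and `χL l : τ⁻¹ l → ξ⁻¹ l`.  The fields are the five occurrences of the
associator in the cube, and the fact that the enumeration of `ψ⁻¹ k` is the same whether `ψ⁻¹ k` is
regarded as a subset of `J` or of `ρ⁻¹ (ξ k)` (which follows from the other fields). -/
structure CubeShape {Ob : Type u} {m n p q : ℕ} (φ : Fin m → Fin n) (ψ : Fin n → Fin p)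
    (ξ : Fin p → Fin q) (χ : Fin m → Fin p) (ρ : Fin n → Fin q) (τ : Fin m → Fin q)
    (bψ : Fin p → ℕ) (eψ : ∀ k, Fin (bψ k) → Fin n)
    (bχ : Fin p → ℕ) (eχ : ∀ k, Fin (bχ k) → Fin m)
    (bξ : Fin q → ℕ) (eξ : ∀ l, Fin (bξ l) → Fin p)
    (bρ : Fin q → ℕ) (eρ : ∀ l, Fin (bρ l) → Fin n)
    (bτ : Fin q → ℕ) (eτ : ∀ l, Fin (bτ l) → Fin m)
    (φK : ∀ k, Fin (bχ k) → Fin (bψ k)) (χL : ∀ l, Fin (bτ l) → Fin (bξ l))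
    (φL : ∀ l, Fin (bτ l) → Fin (bρ l)) (ψL : ∀ l, Fin (bρ l) → Fin (bξ l))
    (eψL : ∀ l k, Fin (bψ (eξ l k)) → Fin (bρ l)) (eχL : ∀ l k, Fin (bχ (eξ l k)) → Fin (bτ l))
    (S : Fin n → List Ob) (T : Fin n → Ob) (S' : Fin p → List Ob) (T' : Fin p → Ob)
    (S'' : Fin q → List Ob) (T'' : Fin q → Ob)
    (R : Fin p → List Ob) (P Q : Fin q → List Ob) (x y z t : List Ob) : Prop where
  shape_χξ : AssocShape χ ξ τ bξ eξ bτ eτ χL R T' S'' T'' Q x z t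
  shape_φψ : AssocShape φ ψ χ bψ eψ bχ eχ φK S T S' T' R x y z
  shape_restrict : ∀ l, AssocShape (φL l) (ψL l) (χL l)
    (fun k => bψ (eξ l k)) (eψL l) (fun k => bχ (eξ l k)) (eχL l) (fun k => φK (eξ l k))
    (fun j => S (eρ l j)) (fun j => T (eρ l j)) (fun k => S' (eξ l k)) (fun k => T' (eξ l k))
    (fun k => R (eξ l k)) (Q l) (P l) (S'' l)
  shape_φρ : AssocShape φ ρ τ bρ eρ bτ eτ φL S T P T'' Q x y t
  shape_ψξ : AssocShape ψ ξ ρ bξ eξ bρ eρ ψL S' T' S'' T'' P y z t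
  enum_eq : ∀ l k s, eρ l (eψL l k s) = eψ (eξ l k) s

/-! ## Symmetric weak multicategories -/

/-- The objects, hom-categories, composition functors and identities of a symmetric weak
multicategory.  For a map `φ : Fin m → Fin n`, the functor `comp` composes morphisms
`f j : (X i)_{i ∈ φ⁻¹ j} → Y j` with `g : (Y j)_j → z`. -/
structure WeakMulticatData where
  Ob : Type u
  Hom : List Ob → Ob → Type v
  [cat : ∀ x z, Category.{w} (Hom x z)]
  comp : ∀ {m n : ℕ} {φ : Fin m → Fin n} {S : Fin n → List Ob} {T : Fin n → Ob} {x y : List Ob}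
    (_ : Composable φ S T x y) (z : Ob), (∀ j, Hom (S j) (T j)) × Hom y z ⥤ Hom x z
  one : ∀ X : Ob, Hom [X] X

attribute [instance] WeakMulticatData.cat

namespace WeakMulticatData

variable (V : WeakMulticatData.{u, v, w})

section basic

variable {V} {m n : ℕ} {φ : Fin m → Fin n} {S : Fin n → List V.Ob} {T : Fin n → V.Ob}
  {x y : List V.Ob} {z : V.Ob}

/-- The composite `μ_φ ((f j)_j, g)`. -/
abbrev mu (h : Composable φ S T x y) (f : ∀ j, V.Hom (S j) (T j)) (g : V.Hom y z) : V.Hom x z :=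
  (V.comp h z).obj (f, g)

/-- The action of `μ_φ` on 2-morphisms. -/
abbrev muMap (h : Composable φ S T x y) {f f' : ∀ j, V.Hom (S j) (T j)} {g g' : V.Hom y z}
    (a : ∀ j, f j ⟶ f' j) (b : g ⟶ g') : mu h f g ⟶ mu h f' g' :=
  (V.comp h z).map (Prod.mkHom (X₁ := f) (X₂ := f') a b)

theorem muMap_id (h : Composable φ S T x y) (f : ∀ j, V.Hom (S j) (T j)) (g : V.Hom y z) :
    muMap h (fun j => 𝟙 (f j)) (𝟙 g) = 𝟙 (mu h f g) :=
  (V.comp h z).map_id (f, g)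

theorem muMap_comp (h : Composable φ S T x y) {f f' f'' : ∀ j, V.Hom (S j) (T j)}
    {g g' g'' : V.Hom y z} (a : ∀ j, f j ⟶ f' j) (a' : ∀ j, f' j ⟶ f'' j)
    (b : g ⟶ g') (b' : g' ⟶ g'') :
    muMap h (fun j => a j ≫ a' j) (b ≫ b') = muMap h a b ≫ muMap h a' b' :=
  (V.comp h z).map_comp (Prod.mkHom (X₁ := f) (X₂ := f') a b)
    (Prod.mkHom (X₁ := f') (X₂ := f'') a' b')

/-- Composites of subfamilies of `f` along equal index functions are equal. -/
theorem mu_reindex {m' n' : ℕ} {φ' : Fin m' → Fin n'} {e e' : Fin n' → Fin n} {x' y' : List V.Ob}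
    (he : ∀ s, e s = e' s)
    (h : Composable φ' (fun s => S (e s)) (fun s => T (e s)) x' y')
    (h' : Composable φ' (fun s => S (e' s)) (fun s => T (e' s)) x' y')
    (f : ∀ j, V.Hom (S j) (T j)) (g : V.Hom y' z) :
    mu h (fun s => f (e s)) g = mu h' (fun s => f (e' s)) g := by
  obtain rfl : e = e' := funext he
  rfl

end basic

section assoc

variable {V} {m n p : ℕ} {φ : Fin m → Fin n} {ψ : Fin n → Fin p}
  {χ : Fin m → Fin p} {b : Fin p → ℕ} {e : ∀ k, Fin (b k) → Fin n} {c : Fin p → ℕ}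
  {d : ∀ k, Fin (c k) → Fin m} {φr : ∀ k, Fin (c k) → Fin (b k)}
  {S : Fin n → List V.Ob} {T : Fin n → V.Ob} {S' : Fin p → List V.Ob} {T' : Fin p → V.Ob}
  {R : Fin p → List V.Ob} {x y z : List V.Ob}

/-- The functor `((f j)_j, (g k)_k, h) ↦ μ_χ ((μ_{φ_k} ((f j)_{j ∈ ψ⁻¹ k}, g k))_k, h)`. -/
def assocSource (A : AssocShape φ ψ χ b e c d φr S T S' T' R x y z) (W : V.Ob) :
    (∀ j, V.Hom (S j) (T j)) × (∀ k, V.Hom (S' k) (T' k)) × V.Hom z W ⥤ V.Hom x W where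
  obj F := mu A.whole (fun k => mu (A.part k) (fun s => F.1 (e k s)) (F.2.1 k)) F.2.2
  map θ := muMap A.whole (fun k => muMap (A.part k) (fun s => θ.1 (e k s)) (θ.2.1 k)) θ.2.2
  map_id F := by
    refine Eq.trans ?_ (muMap_id A.whole _ _)
    congr 1
    funext k
    exact muMap_id (A.part k) _ _
  map_comp θ θ' := by
    refine Eq.trans ?_ (muMap_comp A.whole _ _ _ _)
    congr 1
    funext k
    exact muMap_comp (A.part k) _ _ _ _

/-- The functor `((f j)_j, (g k)_k, h) ↦ μ_φ ((f j)_j, μ_ψ ((g k)_k, h))`. -/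
def assocTarget (A : AssocShape φ ψ χ b e c d φr S T S' T' R x y z) (W : V.Ob) :
    (∀ j, V.Hom (S j) (T j)) × (∀ k, V.Hom (S' k) (T' k)) × V.Hom z W ⥤ V.Hom x W where
  obj F := mu A.fst F.1 (mu A.snd F.2.1 F.2.2)
  map θ := muMap A.fst θ.1 (muMap A.snd θ.2.1 θ.2.2)
  map_id F := by
    refine Eq.trans ?_ (muMap_id A.fst _ _)
    congr 1
    exact muMap_id A.snd _ _
  map_comp θ θ' := by
    refine Eq.trans ?_ (muMap_comp A.fst _ _ _ _)
    congr 1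
    exact muMap_comp A.snd _ _ _ _

end assoc

section units

variable {V}

/-- The functor `f ↦ μ_∇ (f, 1_z)` for `∇ : I → 1`, where `I` is the index set of `x`. -/
def rightUnitSource {a : ℕ} {x : List V.Ob} {z : V.Ob}
    (h : Composable (fun _ : Fin a => (0 : Fin 1)) (fun _ => x) (fun _ => z) x [z]) :
    V.Hom x z ⥤ V.Hom x z where
  obj f := mu h (fun _ => f) (V.one z)
  map α := muMap h (fun _ => α) (𝟙 _)
  map_id f := muMap_id h _ _
  map_comp α β := by
    refine Eq.trans ?_ (muMap_comp h _ _ _ _)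
    rw [Category.comp_id]

/-- The functor `g ↦ μ_φ ((1_{T j})_j, g)`, for a map `φ` all of whose fibre families are the
one-element families `(T j)`. -/
def precompOnes {m n : ℕ} {φ : Fin m → Fin n} {T : Fin n → V.Ob} {x y : List V.Ob}
    (h : Composable φ (fun j => [T j]) T x y) (z : V.Ob) : V.Hom y z ⥤ V.Hom x z where
  obj g := mu h (fun j => V.one (T j)) g
  map β := muMap h (fun _ => 𝟙 _) β
  map_id g := muMap_id h _ _
  map_comp α β := by
    refine Eq.trans ?_ (muMap_comp h _ _ _ _)
    congr 1
    funext j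
    exact (Category.comp_id _).symm

end units

end WeakMulticatData

open WeakMulticatData in
/-- Symmetric multicategories weakly enriched in categories. -/
structure SymmetricWeakMulticategory extends WeakMulticatData.{u, v, w} where
  /-- The associator `ν_{φ,ψ}`. -/
  ν : ∀ {m n p : ℕ} {φ : Fin m → Fin n} {ψ : Fin n → Fin p} {χ : Fin m → Fin p}
    {b : Fin p → ℕ} {e : ∀ k, Fin (b k) → Fin n} {c : Fin p → ℕ} {d : ∀ k, Fin (c k) → Fin m}
    {φr : ∀ k, Fin (c k) → Fin (b k)} {S : Fin n → List Ob} {T : Fin n → Ob}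
    {S' : Fin p → List Ob} {T' : Fin p → Ob} {R : Fin p → List Ob} {x y z : List Ob}
    (A : AssocShape φ ψ χ b e c d φr S T S' T' R x y z) (W : Ob),
    assocSource (V := toWeakMulticatData) A W ≅ assocTarget (V := toWeakMulticatData) A W
  /-- The right unitor `ζ_I : μ_∇ (-, 1_z) ≅ Id`. -/
  ζ : ∀ {a : ℕ} {x : List Ob} {z : Ob}
    (h : Composable (fun _ : Fin a => (0 : Fin 1)) (fun _ => x) (fun _ => z) x [z]),
    rightUnitSource (V := toWeakMulticatData) h ≅ 𝟭 (Hom x z)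
  /-- The left unitor `θ_I : μ_id ((1_{X i})_i, -) ≅ Id` on morphisms out of
  `x = (X i)_{i ∈ I}`. -/
  θ : ∀ {n : ℕ} {X : Fin n → Ob} {x : List Ob}
    (h : Composable (fun i : Fin n => i) (fun i => [X i]) X x x) (z : Ob),
    precompOnes (V := toWeakMulticatData) h z ≅ 𝟭 (Hom x z)
  /-- The associativity cube.  The equality of objects in the `eqToHom` only identifies two
  descriptions of the subfamily of `f` indexed by `ψ⁻¹ k`. -/
  assoc_cube : ∀ {m n p q : ℕ} {φ : Fin m → Fin n} {ψ : Fin n → Fin p}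
    {ξ : Fin p → Fin q} {χ : Fin m → Fin p} {ρ : Fin n → Fin q} {τ : Fin m → Fin q}
    {bψ : Fin p → ℕ} {eψ : ∀ k, Fin (bψ k) → Fin n}
    {bχ : Fin p → ℕ} {eχ : ∀ k, Fin (bχ k) → Fin m}
    {bξ : Fin q → ℕ} {eξ : ∀ l, Fin (bξ l) → Fin p}
    {bρ : Fin q → ℕ} {eρ : ∀ l, Fin (bρ l) → Fin n}
    {bτ : Fin q → ℕ} {eτ : ∀ l, Fin (bτ l) → Fin m}
    {φK : ∀ k, Fin (bχ k) → Fin (bψ k)} {χL : ∀ l, Fin (bτ l) → Fin (bξ l)}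
    {φL : ∀ l, Fin (bτ l) → Fin (bρ l)} {ψL : ∀ l, Fin (bρ l) → Fin (bξ l)}
    {eψL : ∀ l k, Fin (bψ (eξ l k)) → Fin (bρ l)} {eχL : ∀ l k, Fin (bχ (eξ l k)) → Fin (bτ l)}
    {S : Fin n → List Ob} {T : Fin n → Ob} {S' : Fin p → List Ob} {T' : Fin p → Ob}
    {S'' : Fin q → List Ob} {T'' : Fin q → Ob}
    {R : Fin p → List Ob} {P Q : Fin q → List Ob} {x y z t : List Ob}
    (A : CubeShape φ ψ ξ χ ρ τ bψ eψ bχ eχ bξ eξ bρ eρ bτ eτ φK χL φL ψL eψL eχL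
      S T S' T' S'' T'' R P Q x y z t)
    {U : Ob} (f : ∀ j, Hom (S j) (T j)) (g : ∀ k, Hom (S' k) (T' k))
    (h : ∀ l, Hom (S'' l) (T'' l)) (k : Hom t U),
    (ν A.shape_χξ U).hom.app
        (fun k => mu (V := toWeakMulticatData) (A.shape_φψ.part k) (fun s => f (eψ k s)) (g k),
          h, k) ≫
      (ν A.shape_φψ U).hom.app (f, g, mu (V := toWeakMulticatData) A.shape_χξ.snd h k) =
    muMap (V := toWeakMulticatData) A.shape_φρ.whole
        (fun l =>
          eqToHom (congrArg
            (fun r => mu (V := toWeakMulticatData) (A.shape_χξ.part l) r (h l))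
            (funext fun k => (mu_reindex (V := toWeakMulticatData) (A.enum_eq l k)
              ((A.shape_restrict l).part k) (A.shape_φψ.part (eξ l k)) f (g (eξ l k))).symm)) ≫
          (ν (A.shape_restrict l) (T'' l)).hom.app
            (fun j => f (eρ l j), fun k => g (eξ l k), h l))
        (𝟙 k) ≫
      (ν A.shape_φρ U).hom.app
        (f, fun l => mu (V := toWeakMulticatData) (A.shape_ψξ.part l) (fun s => g (eξ l s)) (h l),
          k) ≫
      muMap (V := toWeakMulticatData) A.shape_φρ.fst (fun j => 𝟙 (f j))
        ((ν A.shape_ψξ U).hom.app (g, h, k))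
  /-- The unit equation for `I --φ--> J --id--> J`. -/
  unit_axiom : ∀ {m n : ℕ} {φ : Fin m → Fin n} {c : Fin n → ℕ} {d : ∀ j, Fin (c j) → Fin m}
    {S : Fin n → List Ob} {T : Fin n → Ob} {x y : List Ob}
    (A : AssocShape φ (fun j => j) φ (fun _ => 1) (fun j _ => j) c d (fun _ _ => 0)
      S T (fun j => [T j]) T S x y y)
    {Z : Ob} (f : ∀ j, Hom (S j) (T j)) (g : Hom y Z),
    (ν A Z).hom.app (f, fun j => one (T j), g) ≫
      muMap (V := toWeakMulticatData) A.fst (fun j => 𝟙 (f j)) ((θ A.snd Z).hom.app g) =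
    muMap (V := toWeakMulticatData) A.whole (fun j => (ζ (A.part j)).hom.app (f j)) (𝟙 g)

/-! ## The action of bijections -/

theorem fibreFamily_equiv {Ob : Type u} {m n : ℕ} (α : Fin m ≃ Fin n) (X : Fin m → Ob)
    (Y : Fin n → Ob) (hX : ∀ i, X i = Y (α i)) (j : Fin n) : fibreFamily α X j = [Y j] := by
  have h : (List.finRange m).filter (fun i => α i = j) = [α.symm j] := by
    have h1 : (List.finRange m).filter (fun i => α i = j)
        = (List.finRange m).filter (fun i => i = α.symm j) := by
      apply List.filter_congr
      intro i _
      simp [Equiv.eq_symm_apply]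
    rw [h1, List.filter_eq, List.count_eq_one_of_mem (List.nodup_finRange m)
      (List.mem_finRange _)]
    rfl
  simp [fibreFamily, h, hX]

theorem composable_equiv {Ob : Type u} {m n : ℕ} (α : Fin m ≃ Fin n) {X : Fin m → Ob}
    {Y : Fin n → Ob} (hX : ∀ i, X i = Y (α i)) :
    Composable α (fun j => [Y j]) Y (List.ofFn X) (List.ofFn Y) :=
  ⟨⟨X, rfl, fun j => (fibreFamily_equiv α X Y hX j).symm⟩, rfl⟩

theorem isFibreEnum_equiv {m n : ℕ} (α : Fin m ≃ Fin n) :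
    IsFibreEnum α (fun _ => 1) (fun j _ => α.symm j) :=
  ⟨fun _ => Subsingleton.strictMono _, fun j i => by
    constructor
    · intro h
      exact ⟨0, by simp [← h]⟩
    · rintro ⟨_, rfl⟩
      simp⟩

theorem assocShape_equiv {Ob : Type u} {m n p : ℕ} (α : Fin m ≃ Fin n) (β : Fin n ≃ Fin p)
    (γ : Fin m ≃ Fin p) (hγ : ∀ i, γ i = β (α i)) {X : Fin m → Ob} {Y : Fin n → Ob}
    {Z : Fin p → Ob} (hX : ∀ i, X i = Y (α i)) (hY : ∀ j, Y j = Z (β j)) :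
    AssocShape α β γ (fun _ => 1) (fun k _ => β.symm k) (fun _ => 1) (fun k _ => γ.symm k)
      (fun _ s => s) (fun j => [Y j]) Y (fun k => [Z k]) Z (fun k => [Z k])
      (List.ofFn X) (List.ofFn Y) (List.ofFn Z) where
  comp_eq := hγ
  enum_snd := isFibreEnum_equiv β
  enum_comp := isFibreEnum_equiv γ
  restrict k _ := by simp [Equiv.symm_apply_eq, ← hγ]
  fst := composable_equiv α hX
  snd := composable_equiv β hY
  whole := composable_equiv γ (fun i => by rw [hX, hY, hγ])
  part k := by
    have h := composable_equiv (Equiv.refl (Fin 1)) (X := fun _ => Z k)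
      (Y := fun _ => Y (β.symm k)) (fun _ => by simp [hY])
    have h' : [Y (β.symm k)] = [Z k] := by simp [hY]
    exact ⟨h.1, h'.symm⟩

namespace SymmetricWeakMulticategory

open WeakMulticatData

variable (V : SymmetricWeakMulticategory.{u, v, w})

/-- The hom-category `V((X i)_{i ∈ I}; U)`. -/
abbrev HomCat {n : ℕ} (X : Fin n → V.Ob) (U : V.Ob) : Type v := V.Hom (List.ofFn X) U

/-- The functor `r_α : V((Y j)_j; U) ⥤ V((X i)_i; U)`, `g ↦ μ_α ((1_{Y j})_j, g)`, for a bijection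
`α : I → J` and families with `X i = Y (α i)`. -/
def r {m n : ℕ} (α : Fin m ≃ Fin n) {X : Fin m → V.Ob} {Y : Fin n → V.Ob}
    (hX : ∀ i, X i = Y (α i)) (U : V.Ob) : V.HomCat Y U ⥤ V.HomCat X U :=
  precompOnes (V := V.toWeakMulticatData) (composable_equiv α hX) U

/-- The comparison isomorphism `φ_{α,β} : r_γ ≅ r_β ⋙ r_α`, where `γ` is `α` followed by `β`:
`μ_γ ((1_{Z k})_k, g) ⟶ μ_γ ((μ_{1 → 1} (1_{Y (β⁻¹ k)}, 1_{Z k}))_k, g)` by the inverses of `θ_1`,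
then `⟶ μ_α ((1_{Y j})_j, μ_β ((1_{Z k})_k, g))` by `ν_{α,β}`. -/
def comparison {m n p : ℕ} (α : Fin m ≃ Fin n) (β : Fin n ≃ Fin p) (γ : Fin m ≃ Fin p)
    (hγ : ∀ i, γ i = β (α i)) {X : Fin m → V.Ob} {Y : Fin n → V.Ob} {Z : Fin p → V.Ob}
    (hX : ∀ i, X i = Y (α i)) (hY : ∀ j, Y j = Z (β j)) (hXZ : ∀ i, X i = Z (γ i)) (U : V.Ob) :
    V.r γ hXZ U ≅ V.r β hY U ⋙ V.r α hX U :=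
  NatIso.ofComponents
    (fun g =>
      (V.comp (composable_equiv γ hXZ) U).mapIso
        (Iso.prod
          (Pi.isoMk (X := fun k => V.one (Z k)) fun k =>
            ((V.θ ((assocShape_equiv α β γ hγ hX hY).part k) (Z k)).app (V.one (Z k))).symm)
          (Iso.refl g)) ≪≫
      (V.ν (assocShape_equiv α β γ hγ hX hY) U).app
        (fun j => V.one (Y j), fun k => V.one (Z k), g))
    (by
      intro g g' a
      set A := assocShape_equiv α β γ hγ hX hY
      let t : ∀ k, V.one (Z k) ⟶ mu (V := V.toWeakMulticatData) (A.part k)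
          (fun _ => V.one (Y (β.symm k))) (V.one (Z k)) :=
        fun k => (V.θ (A.part k) (Z k)).inv.app (V.one (Z k))
      have h1 : muMap (V := V.toWeakMulticatData) A.whole (fun k => 𝟙 (V.one (Z k))) a ≫
          muMap (V := V.toWeakMulticatData) A.whole t (𝟙 g') =
          muMap (V := V.toWeakMulticatData) A.whole t (𝟙 g) ≫
          (assocSource (V := V.toWeakMulticatData) A U).map
            (X := (fun j => V.one (Y j), fun k => V.one (Z k), g))
            (Y := (fun j => V.one (Y j), fun k => V.one (Z k), g'))
            (Prod.mkHom (fun j => 𝟙 (V.one (Y j))) (Prod.mkHom (fun k => 𝟙 (V.one (Z k))) a)) := by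
        refine (muMap_comp A.whole _ _ _ _).symm.trans
          (Eq.trans ?_ (muMap_comp A.whole _ _ _ _))
        congr 1
        · funext k
          refine (Category.id_comp _).trans ((Category.comp_id _).symm.trans ?_)
          congr 1
          exact (muMap_id (A.part k) _ _).symm
        · exact (Category.comp_id _).trans (Category.id_comp _).symm
      have h2 := (V.ν A U).hom.naturality
        (X := (fun j => V.one (Y j), fun k => V.one (Z k), g))
        (Y := (fun j => V.one (Y j), fun k => V.one (Z k), g'))
        (Prod.mkHom (fun j => 𝟙 (V.one (Y j))) (Prod.mkHom (fun k => 𝟙 (V.one (Z k))) a))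
      refine (Category.assoc _ _ _).symm.trans ?_
      refine (congrArg (· ≫ _) h1).trans ?_
      refine (Category.assoc _ _ _).trans ?_
      refine (congrArg (_ ≫ ·) h2).trans ?_
      exact (Category.assoc _ _ _).symm)

/-- The isomorphism `θ_I : r_id ≅ Id`. -/
def rOne {n : ℕ} {X : Fin n → V.Ob} (hX : ∀ i, X i = X ((1 : Equiv.Perm (Fin n)) i)) (U : V.Ob) :
    V.r (1 : Equiv.Perm (Fin n)) hX U ≅ 𝟭 (V.HomCat X U) :=
  V.θ (composable_equiv (1 : Equiv.Perm (Fin n)) hX) U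

end SymmetricWeakMulticategory

/-! ## Weak actions -/

/-- Let a group `G` act from the right on the set `B` (`a b g` is the result of acting by `g` on
`b`), and let `D b`, `b ∈ B`, be categories.  Functors `r g : D b ⥤ D (b g)`, isomorphisms
`κ : r (g h) ≅ r g ⋙ r h` and `η : r 1 ≅ Id` form a weak action of `G` on the collection of
categories `D b` if `κ` satisfies the cocycle identity and `η` is a unit for `κ`. -/
structure IsWeakAction (G : Type*) [Group G] {B : Type*} (a : B → G → B) (D : B → Type*)
    [∀ b, Category (D b)]
    (r : ∀ (g : G) {b c : B}, c = a b g → (D b ⥤ D c))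
    (κ : ∀ (g h k : G) (_ : k = g * h) {b c d : B} (hc : c = a b g) (hd : d = a c h)
      (hd' : d = a b k), r k hd' ≅ r g hc ⋙ r h hd)
    (η : ∀ {b : B} (hb : b = a b 1), r 1 hb ≅ 𝟭 (D b)) : Prop where
  act_one : ∀ b, a b 1 = b
  act_mul : ∀ b g h, a b (g * h) = a (a b g) h
  cocycle : ∀ (g h k gh hk ghk : G) (e₁ : gh = g * h) (e₂ : hk = h * k) (e₃ : ghk = gh * k)
    (e₄ : ghk = g * hk) {b c d f : B} (hc : c = a b g) (hd : d = a c h) (hf : f = a d k)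
    (hd' : d = a b gh) (hf' : f = a c hk) (hf'' : f = a b ghk) (w : D b),
    (κ g hk ghk e₄ hc hf' hf'').hom.app w ≫ (κ h k hk e₂ hd hf hf').hom.app ((r g hc).obj w) =
      (κ gh k ghk e₃ hd' hf hf'').hom.app w ≫ (r k hf).map ((κ g h gh e₁ hc hd hd').hom.app w)
  right_unit : ∀ (g : G) (e : g = g * 1) {b c : B} (hc : c = a b g) (h1 : c = a c 1) (w : D b),
    (κ g 1 g e hc h1 hc).hom.app w ≫ (η h1).hom.app ((r g hc).obj w) = 𝟙 _
  left_unit : ∀ (g : G) (e : g = 1 * g) {b c : B} (hc : c = a b g) (h1 : b = a b 1) (w : D b),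
    (κ 1 g g e h1 hc hc).hom.app w ≫ (r g hc).map ((η h1).hom.app w) = 𝟙 _

/-! Along bijections every fibre has one element, so the cube axiom becomes a pentagon and axiom
(ii) the middle unit triangle of a monoidal category. The argument is the classical one by which
these two axioms imply the remaining unit coherences.

Write μ for composition and o for identities. The functor μ(o, -) is isomorphic to the identity
functor through `θ`, and μ(-, o) through `ζ`; hence both are faithful. The cube for id, id, σ,
combined with axiom (ii) and naturality of ν, gives the left unit triangle after one application of
μ(o, -) (`ν_leftUnit`). Comparing this triangle with axiom (ii) on a single object gives `θ` = `ζ`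
at an identity morphism (`θ_one_eq_rightUnitor`).

Axiom (ii) then says that on identities over one object ν matches the two ways of inserting `θ`
inverse (`θ_inv_cocycle`). The cocycle identity for `φ_{α,β}` is the cube evaluated at identities,
with the inverses of `θ` moved across ν by naturality and compared fibre by fibre using
`θ_inv_cocycle`. One unit law of the action is the left unit triangle; the other is axiom (ii)
together with `θ` = `ζ` on identities. -/

/-! ### Associativity shapes for bijections. -/

/-- This is the restriction of a pair of bijections to the fibre over one point. The objects
attached to that point by the different families are only propositionally equal, hence the three
letters. -/
theorem assocShape_one {Ob : Type u} {X Y Z : Ob} (hX : X = Z) (hY : Y = Z) :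
    AssocShape (fun s : Fin 1 => s) (fun s : Fin 1 => s) (fun s : Fin 1 => s)
      (fun _ => 1) (fun k _ => k) (fun _ => 1) (fun k _ => k) (fun _ s => s)
      (fun _ => [X]) (fun _ => X) (fun _ => [Y]) (fun _ => Y) (fun _ => [Y]) [Z] [Z] [Z] := by
  subst hX hY
  exact assocShape_equiv (Equiv.refl (Fin 1)) (Equiv.refl (Fin 1)) (Equiv.refl (Fin 1))
    (fun _ => rfl) (X := fun _ => Y) (Y := fun _ => Y) (Z := fun _ => Y)
    (fun _ => rfl) (fun _ => rfl)

/-- Fibres of bijections are enumerated by inverses and all restricted maps are the identity of `Fin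
1`. With this choice both enumerations compared in `enum_eq` agree definitionally. -/
theorem cubeShape_equiv {Ob : Type u} {m n p q : ℕ} (α : Fin m ≃ Fin n) (β : Fin n ≃ Fin p)
    (γ : Fin p ≃ Fin q) {X : Fin m → Ob} {Y : Fin n → Ob} {Z : Fin p → Ob} {W : Fin q → Ob}
    (hX : ∀ i, X i = Y (α i)) (hY : ∀ j, Y j = Z (β j)) (hZ : ∀ k, Z k = W (γ k)) :
    CubeShape α β γ (α.trans β) (β.trans γ) (α.trans (β.trans γ))
      (fun _ => 1) (fun k _ => β.symm k) (fun _ => 1) (fun k _ => (α.trans β).symm k)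
      (fun _ => 1) (fun l _ => γ.symm l) (fun _ => 1) (fun l _ => (β.trans γ).symm l)
      (fun _ => 1) (fun l _ => (α.trans (β.trans γ)).symm l)
      (fun _ s => s) (fun _ s => s) (fun _ s => s) (fun _ s => s)
      (fun _ k _ => k) (fun _ k _ => k)
      (fun j => [Y j]) Y (fun k => [Z k]) Z (fun l => [W l]) W
      (fun k => [Z k]) (fun l => [W l]) (fun l => [W l])
      (List.ofFn X) (List.ofFn Y) (List.ofFn Z) (List.ofFn W) where
  shape_χξ := assocShape_equiv (α.trans β) γ (α.trans (β.trans γ)) (fun _ => rfl)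
    (fun i => (hX i).trans (hY (α i))) hZ
  shape_φψ := assocShape_equiv α β (α.trans β) (fun _ => rfl) hX hY
  shape_restrict l := assocShape_one
    (by simp [hY, hZ]) (by simp [hZ])
  shape_φρ := assocShape_equiv α (β.trans γ) (α.trans (β.trans γ)) (fun _ => rfl) hX
    (fun j => (hY j).trans (hZ (β j)))
  shape_ψξ := assocShape_equiv β γ (β.trans γ) (fun _ => rfl) hY hZ
  enum_eq _ _ _ := rfl

namespace SymmetricWeakMulticategory

open WeakMulticatData

variable (V : SymmetricWeakMulticategory.{u, v, w})

/-! ### Naturality of the structural isomorphisms, and faithfulness of composing with identities. -/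

section naturality

variable {V} {m n p : ℕ} {φ : Fin m → Fin n} {ψ : Fin n → Fin p}
  {χ : Fin m → Fin p} {b : Fin p → ℕ} {e : ∀ k, Fin (b k) → Fin n} {c : Fin p → ℕ}
  {d : ∀ k, Fin (c k) → Fin m} {φr : ∀ k, Fin (c k) → Fin (b k)}
  {S : Fin n → List V.Ob} {T : Fin n → V.Ob} {S' : Fin p → List V.Ob} {T' : Fin p → V.Ob}
  {R : Fin p → List V.Ob} {x y z : List V.Ob}

/-- The component of the associator `ν`. -/
def assocIso (A : AssocShape φ ψ χ b e c d φr S T S' T' R x y z) {W : V.Ob}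
    (f : ∀ j, V.Hom (S j) (T j)) (g : ∀ k, V.Hom (S' k) (T' k)) (h : V.Hom z W) :
    mu (V := V.toWeakMulticatData) A.whole
        (fun k => mu (V := V.toWeakMulticatData) (A.part k) (fun i => f (e k i)) (g k)) h ≅
      mu (V := V.toWeakMulticatData) A.fst f (mu (V := V.toWeakMulticatData) A.snd g h) :=
  (V.ν A W).app (f, g, h)

/-- The component of the left unitor `θ`. -/
def leftUnitor {X : Fin n → V.Ob}
    (c : Composable (fun i : Fin n => i) (fun i => [X i]) X x x) {U : V.Ob} (g : V.Hom x U) :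
    mu (V := V.toWeakMulticatData) c (fun i => V.one (X i)) g ≅ g :=
  (V.θ c U).app g

theorem ν_naturality (A : AssocShape φ ψ χ b e c d φr S T S' T' R x y z) {W : V.Ob}
    {f f' : ∀ j, V.Hom (S j) (T j)} {g g' : ∀ k, V.Hom (S' k) (T' k)} {h h' : V.Hom z W}
    (s : ∀ j, f j ⟶ f' j) (t : ∀ k, g k ⟶ g' k) (a : h ⟶ h') :
    muMap (V := V.toWeakMulticatData) A.whole
        (fun k => muMap (V := V.toWeakMulticatData) (A.part k) (fun i => s (e k i)) (t k)) a ≫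
        (assocIso A f' g' h').hom =
      (assocIso A f g h).hom ≫
        muMap (V := V.toWeakMulticatData) A.fst s
          (muMap (V := V.toWeakMulticatData) A.snd t a) :=
  (V.ν A W).hom.naturality (X := (f, g, h)) (Y := (f', g', h'))
    (Prod.mkHom s (Prod.mkHom t a))

theorem θ_naturality {X : Fin n → V.Ob}
    (c : Composable (fun i : Fin n => i) (fun i => [X i]) X x x) {U : V.Ob} {g g' : V.Hom x U}
    (a : g ⟶ g') :
    muMap (V := V.toWeakMulticatData) c (fun i => 𝟙 (V.one (X i))) a ≫ (leftUnitor c g').hom =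
      (leftUnitor c g).hom ≫ a :=
  (V.θ c U).hom.naturality a

/-- By naturality of `θ`, the functor is isomorphic to the identity functor. -/
theorem precompose_identities_faithful {X : Fin n → V.Ob}
    (c : Composable (fun i : Fin n => i) (fun i => [X i]) X x x) {U : V.Ob} {g g' : V.Hom x U}
    {a a' : g ⟶ g'}
    (h : muMap (V := V.toWeakMulticatData) c (fun i => 𝟙 (V.one (X i))) a =
      muMap (V := V.toWeakMulticatData) c (fun i => 𝟙 (V.one (X i))) a') : a = a' := by
  rw [← cancel_epi (leftUnitor c g).hom]
  exact (θ_naturality c a).symm.trans ((congrArg (· ≫ _) h).trans (θ_naturality c a'))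

theorem muMap_comp_left (c : Composable φ S T x y) {U : V.Ob} {f f' f'' : ∀ j, V.Hom (S j) (T j)}
    (g : V.Hom y U) (s : ∀ j, f j ⟶ f' j) (s' : ∀ j, f' j ⟶ f'' j) :
    muMap (V := V.toWeakMulticatData) c (fun j => s j ≫ s' j) (𝟙 g) =
      muMap (V := V.toWeakMulticatData) c s (𝟙 g) ≫
        muMap (V := V.toWeakMulticatData) c s' (𝟙 g) := by
  rw [← muMap_comp, Category.comp_id]

theorem muMap_comp_right (c : Composable φ S T x y) {U : V.Ob} (f : ∀ j, V.Hom (S j) (T j))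
    {g g' g'' : V.Hom y U} (a : g ⟶ g') (a' : g' ⟶ g'') :
    muMap (V := V.toWeakMulticatData) c (fun j => 𝟙 (f j)) (a ≫ a') =
      muMap (V := V.toWeakMulticatData) c (fun j => 𝟙 (f j)) a ≫
        muMap (V := V.toWeakMulticatData) c (fun j => 𝟙 (f j)) a' := by
  rw [← muMap_comp]
  simp only [Category.comp_id]

theorem ν_naturality_fst (A : AssocShape φ ψ χ b e c d φr S T S' T' R x y z) {W : V.Ob}
    {f f' : ∀ j, V.Hom (S j) (T j)} (g : ∀ k, V.Hom (S' k) (T' k)) (h : V.Hom z W)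
    (s : ∀ j, f j ⟶ f' j) :
    muMap (V := V.toWeakMulticatData) A.whole
        (fun k => muMap (V := V.toWeakMulticatData) (A.part k) (fun i => s (e k i)) (𝟙 (g k)))
        (𝟙 h) ≫ (assocIso A f' g h).hom =
      (assocIso A f g h).hom ≫ muMap (V := V.toWeakMulticatData) A.fst s (𝟙 _) := by
  rw [ν_naturality A s (fun k => 𝟙 (g k)) (𝟙 h), muMap_id]

theorem ν_naturality_snd (A : AssocShape φ ψ χ b e c d φr S T S' T' R x y z) {W : V.Ob}
    (f : ∀ j, V.Hom (S j) (T j)) {g g' : ∀ k, V.Hom (S' k) (T' k)} (h : V.Hom z W)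
    (t : ∀ k, g k ⟶ g' k) :
    muMap (V := V.toWeakMulticatData) A.whole
        (fun k => muMap (V := V.toWeakMulticatData) (A.part k) (fun i => 𝟙 (f (e k i))) (t k))
        (𝟙 h) ≫ (assocIso A f g' h).hom =
      (assocIso A f g h).hom ≫ muMap (V := V.toWeakMulticatData) A.fst (fun j => 𝟙 (f j))
        (muMap (V := V.toWeakMulticatData) A.snd t (𝟙 h)) :=
  ν_naturality A (fun j => 𝟙 (f j)) t (𝟙 h)

/-- It permits cancelling composites of structural isomorphisms in the diagram chases below. -/
instance muMap_isIso (c : Composable φ S T x y) {U : V.Ob} {f f' : ∀ j, V.Hom (S j) (T j)}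
    {g g' : V.Hom y U} (s : ∀ j, f j ⟶ f' j) (a : g ⟶ g') [∀ j, IsIso (s j)] [IsIso a] :
    IsIso (muMap (V := V.toWeakMulticatData) c s a) := by
  refine ⟨muMap (V := V.toWeakMulticatData) c (fun j => inv (s j)) (inv a), ?_, ?_⟩
  · rw [← muMap_comp]
    simp only [IsIso.hom_inv_id]
    exact muMap_id c f g
  · rw [← muMap_comp]
    simp only [IsIso.inv_hom_id]
    exact muMap_id c f' g'

/-- The right unitor along any spelling of the map to the one-element ordinal. -/
def rightUnitor {a : ℕ} {φ : Fin a → Fin 1} {z : V.Ob}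
    (c : Composable φ (fun _ => x) (fun _ => z) x [z]) (f : V.Hom x z) :
    mu (V := V.toWeakMulticatData) c (fun _ => f) (V.one z) ≅ f := by
  obtain rfl : φ = fun _ => 0 := Subsingleton.elim _ _
  exact (V.ζ c).app f

theorem rightUnitor_naturality {a : ℕ} {φ : Fin a → Fin 1} {z : V.Ob}
    (c : Composable φ (fun _ => x) (fun _ => z) x [z]) {f f' : V.Hom x z} (s : f ⟶ f') :
    muMap (V := V.toWeakMulticatData) c (fun _ => s) (𝟙 (V.one z)) ≫ (rightUnitor c f').hom =
      (rightUnitor c f).hom ≫ s := by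
  obtain rfl : φ = fun _ => 0 := Subsingleton.elim _ _
  exact (V.ζ c).hom.naturality s

theorem postcompose_identity_faithful {a : ℕ} {φ : Fin a → Fin 1} {z : V.Ob}
    (c : Composable φ (fun _ => x) (fun _ => z) x [z]) {f f' : V.Hom x z} {s s' : f ⟶ f'}
    (h : muMap (V := V.toWeakMulticatData) c (fun _ => s) (𝟙 (V.one z)) =
      muMap (V := V.toWeakMulticatData) c (fun _ => s') (𝟙 (V.one z))) : s = s' := by
  rw [← cancel_epi (rightUnitor c f).hom, ← rightUnitor_naturality, h, rightUnitor_naturality]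

/-- Axiom (ii) freed from the literal constant map 0: the shapes of bijections present the
restriction as `fun _ s => s`, which is the same map because `Fin 1` is a subsingleton. -/
theorem ν_unit {c : Fin n → ℕ} {d : ∀ j, Fin (c j) → Fin m} {φr : ∀ j, Fin (c j) → Fin 1}
    (A : AssocShape φ (fun j => j) φ (fun _ => 1) (fun j _ => j) c d φr
      S T (fun j => [T j]) T S x y y)
    {U : V.Ob} (f : ∀ j, V.Hom (S j) (T j)) (g : V.Hom y U) :
    (assocIso A f (fun j => V.one (T j)) g).hom ≫
      muMap (V := V.toWeakMulticatData) A.fst (fun j => 𝟙 (f j)) (leftUnitor A.snd g).hom =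
    muMap (V := V.toWeakMulticatData) A.whole (fun j => (rightUnitor (A.part j) (f j)).hom)
      (𝟙 g) := by
  obtain rfl : φr = fun _ _ => 0 := Subsingleton.elim _ _
  -- The sixth field is `unit_axiom`.
  exact V.6 A f g

end naturality

/-! ### The pentagon for bijections and the derived unit coherences. -/

section coherence

variable {V} {m n p q : ℕ}

/-- For these enumerations the `eqToHom` of the cube axiom compares definitionally equal composites,
so it is an identity and drops out. -/
theorem associativity_cube (α : Fin m ≃ Fin n) (β : Fin n ≃ Fin p) (γ : Fin p ≃ Fin q)
    {X : Fin m → V.Ob} {Y : Fin n → V.Ob} {Z : Fin p → V.Ob} {W : Fin q → V.Ob} {U : V.Ob}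
    (A : CubeShape α β γ (α.trans β) (β.trans γ) (α.trans (β.trans γ))
      (fun _ => 1) (fun k _ => β.symm k) (fun _ => 1) (fun k _ => (α.trans β).symm k)
      (fun _ => 1) (fun l _ => γ.symm l) (fun _ => 1) (fun l _ => (β.trans γ).symm l)
      (fun _ => 1) (fun l _ => (α.trans (β.trans γ)).symm l)
      (fun _ s => s) (fun _ s => s) (fun _ s => s) (fun _ s => s)
      (fun _ k _ => k) (fun _ k _ => k)
      (fun j => [Y j]) Y (fun k => [Z k]) Z (fun l => [W l]) W
      (fun k => [Z k]) (fun l => [W l]) (fun l => [W l])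
      (List.ofFn X) (List.ofFn Y) (List.ofFn Z) (List.ofFn W))
    (f : ∀ j, V.Hom [Y j] (Y j)) (g : ∀ k, V.Hom [Z k] (Z k))
    (h : ∀ l, V.Hom [W l] (W l)) (k : V.HomCat W U) :
    (assocIso A.shape_χξ (fun k => mu (V := V.toWeakMulticatData) (A.shape_φψ.part k)
        (fun _ => f (β.symm k)) (g k)) h k).hom ≫
      (assocIso A.shape_φψ f g (mu (V := V.toWeakMulticatData) A.shape_χξ.snd h k)).hom =
    muMap (V := V.toWeakMulticatData) A.shape_φρ.whole
        (fun l => (assocIso (A.shape_restrict l) (fun _ => f ((β.trans γ).symm l))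
          (fun _ => g (γ.symm l)) (h l)).hom) (𝟙 k) ≫
      (assocIso A.shape_φρ f (fun l => mu (V := V.toWeakMulticatData) (A.shape_ψξ.part l)
        (fun _ => g (γ.symm l)) (h l)) k).hom ≫
      muMap (V := V.toWeakMulticatData) A.shape_φρ.fst (fun j => 𝟙 (f j))
        (assocIso A.shape_ψξ g h k).hom := by
  refine (V.assoc_cube A f g h k).trans ?_
  congr 2
  funext l
  exact Category.id_comp _

/-- The left unit triangle: the associator followed by the left unitor of a composite is the
composite of the left unitors. -/
theorem ν_leftUnit (σ : Fin m ≃ Fin n) {X : Fin m → V.Ob} {Y : Fin n → V.Ob} {U : V.Ob}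
    (A : AssocShape (fun i : Fin m => i) σ σ (fun _ => 1) (fun k _ => σ.symm k)
      (fun _ => 1) (fun k _ => σ.symm k) (fun _ s => s) (fun i => [X i]) X (fun j => [Y j]) Y
      (fun j => [Y j]) (List.ofFn X) (List.ofFn X) (List.ofFn Y))
    (g : V.HomCat Y U) :
    (assocIso A (fun i => V.one (X i)) (fun j => V.one (Y j)) g).hom ≫
        (leftUnitor A.fst
          (mu (V := V.toWeakMulticatData) A.snd (fun j => V.one (Y j)) g)).hom =
      muMap (V := V.toWeakMulticatData) A.snd
        (fun j => (leftUnitor (A.part j) (V.one (Y j))).hom) (𝟙 g) := by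
  -- The matching of one-element families over the point `σ i` already contains this equation.
  have hX : ∀ i, X i = Y (σ i) := fun i => by simpa using (A.part (σ i)).2.symm
  have C := cubeShape_equiv (Equiv.refl (Fin m)) (Equiv.refl (Fin m)) σ
    (fun _ => rfl) (fun _ => rfl) hX
  have B : AssocShape (fun i : Fin m => i) (fun i : Fin m => i) (fun i : Fin m => i)
      (fun _ => 1) (fun k _ => k) (fun _ => 1) (fun k _ => k) (fun _ s => s)
      (fun i => [X i]) X (fun i => [X i]) X (fun i => [X i])
      (List.ofFn X) (List.ofFn X) (List.ofFn X) := C.shape_φψ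
  have B1 : ∀ j, AssocShape (fun s : Fin 1 => s) (fun s : Fin 1 => s) (fun s : Fin 1 => s)
      (fun _ => 1) (fun k _ => k) (fun _ => 1) (fun k _ => k) (fun _ s => s)
      (fun _ => [X (σ.symm j)]) (fun _ => X (σ.symm j)) (fun _ => [X (σ.symm j)])
      (fun _ => X (σ.symm j)) (fun _ => [X (σ.symm j)]) [Y j] [Y j] [Y j] := C.shape_restrict
  let o : ∀ i, V.Hom [X i] (X i) := fun i => V.one (X i)
  let o' : ∀ j, V.Hom [Y j] (Y j) := fun j => V.one (Y j)
  let G := mu (V := V.toWeakMulticatData) A.snd o' g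
  let oo : ∀ i, V.Hom [X i] (X i) :=
    fun i => mu (V := V.toWeakMulticatData) (B.part i) (fun _ => o i) (o i)
  let κ : ∀ j, mu (V := V.toWeakMulticatData) (A.part j) (fun _ => oo (σ.symm j)) (o' j) ⟶
      mu (V := V.toWeakMulticatData) (A.part j) (fun _ => o (σ.symm j))
        (mu (V := V.toWeakMulticatData) (A.part j) (fun _ => o (σ.symm j)) (o' j)) :=
    fun j => (assocIso (B1 j) (fun _ => o (σ.symm j)) (fun _ => o (σ.symm j)) (o' j)).hom
  let l : ∀ j, mu (V := V.toWeakMulticatData) (A.part j) (fun _ => o (σ.symm j)) (o' j) ⟶ o' j :=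
    fun j => (leftUnitor (A.part j) (o' j)).hom
  let ru : ∀ i, oo i ⟶ o i := fun i => (rightUnitor (B.part i) (o i)).hom
  have cube : (assocIso A oo o' g).hom ≫ (assocIso B o o G).hom =
      muMap (V := V.toWeakMulticatData) A.whole κ (𝟙 g) ≫
        (assocIso A o (fun j => mu (V := V.toWeakMulticatData) (A.part j)
          (fun _ => o (σ.symm j)) (o' j)) g).hom ≫
        muMap (V := V.toWeakMulticatData) A.fst (fun i => 𝟙 (o i))
          (assocIso A o o' g).hom :=
    associativity_cube (Equiv.refl (Fin m)) (Equiv.refl (Fin m)) σ C o o o' g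
  -- Axiom (ii) applies both to the whole family (`e1`) and on each fibre (`e4`); `e2` and `e3`
  -- carry the resulting unitors across ν.
  have e1 : (assocIso B o o G).hom ≫
      muMap (V := V.toWeakMulticatData) A.fst (fun i => 𝟙 (o i)) (leftUnitor A.fst G).hom =
      muMap (V := V.toWeakMulticatData) A.fst ru (𝟙 G) := ν_unit B o G
  have e2 : muMap (V := V.toWeakMulticatData) A.whole
        (fun j => muMap (V := V.toWeakMulticatData) (A.part j) (fun _ => ru (σ.symm j))
          (𝟙 (o' j))) (𝟙 g) ≫ (assocIso A o o' g).hom =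
      (assocIso A oo o' g).hom ≫ muMap (V := V.toWeakMulticatData) A.fst ru (𝟙 G) :=
    ν_naturality_fst A o' g ru
  have e3 : muMap (V := V.toWeakMulticatData) A.whole
        (fun j => muMap (V := V.toWeakMulticatData) (A.part j) (fun _ => 𝟙 (o (σ.symm j)))
          (l j)) (𝟙 g) ≫ (assocIso A o o' g).hom =
      (assocIso A o (fun j => mu (V := V.toWeakMulticatData) (A.part j)
          (fun _ => o (σ.symm j)) (o' j)) g).hom ≫
        muMap (V := V.toWeakMulticatData) A.fst (fun i => 𝟙 (o i))
          (muMap (V := V.toWeakMulticatData) A.snd l (𝟙 g)) :=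
    ν_naturality_snd A o g l
  have e4 : ∀ j, κ j ≫ muMap (V := V.toWeakMulticatData) (A.part j)
        (fun _ => 𝟙 (o (σ.symm j))) (l j) =
      muMap (V := V.toWeakMulticatData) (A.part j) (fun _ => ru (σ.symm j)) (𝟙 (o' j)) :=
    fun j => ν_unit (B1 j) (fun _ => o (σ.symm j)) (o' j)
  -- The cube contains the desired triangle only inside μ(o, -), preceded by two isomorphisms;
  -- faithfulness and cancellation extract it.
  apply precompose_identities_faithful A.fst
  have hκ : ∀ j, IsIso (κ j) := fun j => by dsimp only [κ]; infer_instance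
  rw [← cancel_epi ((assocIso A o (fun j => mu (V := V.toWeakMulticatData) (A.part j)
          (fun _ => o (σ.symm j)) (o' j)) g).hom),
    ← cancel_epi (muMap (V := V.toWeakMulticatData) A.whole κ (𝟙 g))]
  calc
    _ = (assocIso A oo o' g).hom ≫ (assocIso B o o G).hom ≫
        muMap (V := V.toWeakMulticatData) A.fst (fun i => 𝟙 (o i))
          (leftUnitor A.fst G).hom := by
      rw [← Category.assoc (assocIso A oo o' g).hom, cube, muMap_comp_right]
      simp only [Category.assoc]
      rfl
    _ = muMap (V := V.toWeakMulticatData) A.whole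
          (fun j => κ j ≫ muMap (V := V.toWeakMulticatData) (A.part j)
            (fun _ => 𝟙 (o (σ.symm j))) (l j)) (𝟙 g) ≫ (assocIso A o o' g).hom := by
      rw [e1, ← e2]
      simp only [e4]
    _ = _ := by
      rw [muMap_comp_left, Category.assoc, e3]

/-- The left and right unitors agree on identities. -/
theorem θ_one_eq_rightUnitor {X : V.Ob}
    (c' : Composable (fun s : Fin 1 => s) (fun _ => [X]) (fun _ => X) [X] [X]) :
    (leftUnitor c' (V.one X)).hom = (rightUnitor c' (V.one X)).hom := by
  apply postcompose_identity_faithful c'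
  have A := assocShape_one (rfl : X = X) (rfl : X = X)
  let o := V.one X
  have h1 : (assocIso A (fun _ => o) (fun _ => o) o).hom ≫
      (leftUnitor c' (mu (V := V.toWeakMulticatData) c' (fun _ => o) o)).hom =
      muMap (V := V.toWeakMulticatData) c' (fun _ => (leftUnitor c' o).hom) (𝟙 o) :=
    ν_leftUnit (Equiv.refl (Fin 1)) A o
  have h2 : (assocIso A (fun _ => o) (fun _ => o) o).hom ≫
      muMap (V := V.toWeakMulticatData) c' (fun _ => 𝟙 o) (leftUnitor c' o).hom =
      muMap (V := V.toWeakMulticatData) c' (fun _ => (rightUnitor c' o).hom) (𝟙 o) :=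
    ν_unit A (fun _ => o) o
  -- Naturality of `θ` at its own component at `o`, followed by cancelling that component.
  have h3 : muMap (V := V.toWeakMulticatData) c' (fun _ => 𝟙 o) (leftUnitor c' o).hom =
      (leftUnitor c' (mu (V := V.toWeakMulticatData) c' (fun _ => o) o)).hom := by
    rw [← cancel_mono (leftUnitor c' o).hom]
    exact θ_naturality c' _
  exact h1.symm.trans ((congrArg (_ ≫ ·) h3.symm).trans h2)

/-- The cocycle identity for identity morphisms over one object. -/
theorem θ_inv_cocycle {X Y Z : V.Ob} (hX : X = Z) (hY : Y = Z)
    (A : AssocShape (fun s : Fin 1 => s) (fun s : Fin 1 => s) (fun s : Fin 1 => s)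
      (fun _ => 1) (fun k _ => k) (fun _ => 1) (fun k _ => k) (fun _ s => s)
      (fun _ => [X]) (fun _ => X) (fun _ => [Y]) (fun _ => Y) (fun _ => [Y]) [Z] [Z] [Z]) :
    (leftUnitor A.snd (V.one Z)).inv ≫
        muMap (V := V.toWeakMulticatData) A.snd
          (fun k => (leftUnitor (A.part k) (V.one Y)).inv) (𝟙 (V.one Z)) ≫
        (assocIso A (fun _ => V.one X) (fun _ => V.one Y) (V.one Z)).hom =
      (leftUnitor A.fst (V.one Z)).inv ≫
        muMap (V := V.toWeakMulticatData) A.fst (fun _ => 𝟙 (V.one X))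
          (leftUnitor A.snd (V.one Z)).inv := by
  -- Once the objects coincide, all the left unitors at the identity are one isomorphism `l`.
  subst hX hY
  let o := V.one Y
  let l := leftUnitor A.snd o
  have h : (assocIso A (fun _ => o) (fun _ => o) o).hom ≫
      muMap (V := V.toWeakMulticatData) A.fst (fun _ => 𝟙 o) l.hom =
      muMap (V := V.toWeakMulticatData) A.snd (fun _ => l.hom) (𝟙 o) :=
    (ν_unit A (fun _ => o) o).trans
      (congrArg (fun s => muMap (V := V.toWeakMulticatData) A.snd (fun _ => s) (𝟙 o))
        (θ_one_eq_rightUnitor A.snd).symm)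
  have h' : muMap (V := V.toWeakMulticatData) A.snd (fun _ => l.inv) (𝟙 o) ≫
      (assocIso A (fun _ => o) (fun _ => o) o).hom =
      muMap (V := V.toWeakMulticatData) A.fst (fun _ => 𝟙 o) l.inv := by
    rw [← cancel_mono (muMap (V := V.toWeakMulticatData) A.fst (fun _ => 𝟙 o) l.hom),
      Category.assoc, h, ← muMap_comp_left, ← muMap_comp_right, Iso.inv_hom_id, muMap_id]
  exact congrArg (l.inv ≫ ·) h'

/-! ### The cocycle identity and the unit laws for the comparison isomorphisms. -/

/-- The composites are separate variables with pointwise equations so that the result also applies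
to products in a permutation group, where composites are given by propositional equalities. -/
theorem comparison_cocycle (α : Fin m ≃ Fin n) (β : Fin n ≃ Fin p) (γ : Fin p ≃ Fin q)
    (χ : Fin m ≃ Fin p) (ρ : Fin n ≃ Fin q) (τ : Fin m ≃ Fin q)
    (hχ : ∀ i, χ i = β (α i)) (hρ : ∀ j, ρ j = γ (β j))
    (hτ : ∀ i, τ i = ρ (α i)) (hτ' : ∀ i, τ i = γ (χ i))
    {X : Fin m → V.Ob} {Y : Fin n → V.Ob} {Z : Fin p → V.Ob} {W : Fin q → V.Ob} {U : V.Ob}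
    (hX : ∀ i, X i = Y (α i)) (hY : ∀ j, Y j = Z (β j)) (hZ : ∀ k, Z k = W (γ k))
    (hXZ : ∀ i, X i = Z (χ i)) (hYW : ∀ j, Y j = W (ρ j)) (hXW : ∀ i, X i = W (τ i))
    (g : V.HomCat W U) :
    (V.comparison α ρ τ hτ hX hYW hXW U).hom.app g ≫
        (V.r α hX U).map ((V.comparison β γ ρ hρ hY hZ hYW U).hom.app g) =
      (V.comparison χ γ τ hτ' hXZ hZ hXW U).hom.app g ≫
        (V.comparison α β χ hχ hX hY hXZ U).hom.app ((V.r γ hZ U).obj g) := by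
  obtain rfl : χ = α.trans β := Equiv.ext hχ
  obtain rfl : ρ = β.trans γ := Equiv.ext hρ
  obtain rfl : τ = α.trans (β.trans γ) := Equiv.ext hτ
  have C := cubeShape_equiv α β γ hX hY hZ
  let oY : ∀ j, V.Hom [Y j] (Y j) := fun j => V.one (Y j)
  let oZ : ∀ k, V.Hom [Z k] (Z k) := fun k => V.one (Z k)
  let oW : ∀ l, V.Hom [W l] (W l) := fun l => V.one (W l)
  let G := mu (V := V.toWeakMulticatData) C.shape_ψξ.snd oW g
  let YZ : ∀ k, V.Hom [Z k] (Z k) := fun k => mu (V := V.toWeakMulticatData)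
    (C.shape_φψ.part k) (fun _ => oY (β.symm k)) (oZ k)
  let ZW : ∀ l, V.Hom [W l] (W l) := fun l => mu (V := V.toWeakMulticatData)
    (C.shape_ψξ.part l) (fun _ => oZ (γ.symm l)) (oW l)
  let YW : ∀ l, V.Hom [W l] (W l) := fun l => mu (V := V.toWeakMulticatData)
    (C.shape_φρ.part l) (fun _ => oY ((β.trans γ).symm l)) (oW l)
  let lYZ : ∀ k, YZ k ≅ oZ k := fun k => leftUnitor (C.shape_φψ.part k) (oZ k)
  let lZW : ∀ l, ZW l ≅ oW l := fun l => leftUnitor (C.shape_ψξ.part l) (oW l)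
  let lYW : ∀ l, YW l ≅ oW l := fun l => leftUnitor (C.shape_φρ.part l) (oW l)
  let κ : ∀ l, mu (V := V.toWeakMulticatData) (C.shape_χξ.part l)
        (fun _ => YZ (γ.symm l)) (oW l) ⟶
      mu (V := V.toWeakMulticatData) (C.shape_φρ.part l) (fun _ => oY ((β.trans γ).symm l))
        (ZW l) :=
    fun l => (assocIso (C.shape_restrict l) (fun _ => oY ((β.trans γ).symm l))
      (fun _ => oZ (γ.symm l)) (oW l)).hom
  have cube : (assocIso C.shape_χξ YZ oW g).hom ≫ (assocIso C.shape_φψ oY oZ G).hom =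
      muMap (V := V.toWeakMulticatData) C.shape_φρ.whole κ (𝟙 g) ≫
        (assocIso C.shape_φρ oY ZW g).hom ≫
        muMap (V := V.toWeakMulticatData) C.shape_φρ.fst (fun j => 𝟙 (oY j))
          (assocIso C.shape_ψξ oZ oW g).hom :=
    associativity_cube α β γ C oY oZ oW g
  have e1 : muMap (V := V.toWeakMulticatData) C.shape_φρ.whole
        (fun l => muMap (V := V.toWeakMulticatData) (C.shape_φρ.part l)
          (fun _ => 𝟙 (oY ((β.trans γ).symm l))) (lZW l).inv) (𝟙 g) ≫
        (assocIso C.shape_φρ oY ZW g).hom =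
      (assocIso C.shape_φρ oY oW g).hom ≫
        muMap (V := V.toWeakMulticatData) C.shape_φρ.fst (fun j => 𝟙 (oY j))
          (muMap (V := V.toWeakMulticatData) C.shape_ψξ.whole (fun l => (lZW l).inv) (𝟙 g)) :=
    ν_naturality_snd C.shape_φρ oY g (fun l => (lZW l).inv)
  have e2 : muMap (V := V.toWeakMulticatData) C.shape_φρ.whole
        (fun l => muMap (V := V.toWeakMulticatData) (C.shape_χξ.part l)
          (fun _ => (lYZ (γ.symm l)).inv) (𝟙 (oW l))) (𝟙 g) ≫
        (assocIso C.shape_χξ YZ oW g).hom =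
      (assocIso C.shape_χξ oZ oW g).hom ≫
        muMap (V := V.toWeakMulticatData) C.shape_φψ.whole (fun k => (lYZ k).inv) (𝟙 G) :=
    ν_naturality_fst C.shape_χξ oW g (fun k => (lYZ k).inv)
  -- Over each point `l` only identities are involved, and the statement is the cocycle identity on
  -- one object.
  have e3 : ∀ l, (lZW l).inv ≫ muMap (V := V.toWeakMulticatData) (C.shape_χξ.part l)
        (fun _ => (lYZ (γ.symm l)).inv) (𝟙 (oW l)) ≫ κ l =
      (lYW l).inv ≫ muMap (V := V.toWeakMulticatData) (C.shape_φρ.part l)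
        (fun _ => 𝟙 (oY ((β.trans γ).symm l))) (lZW l).inv := fun l =>
    θ_inv_cocycle (by simp [hY, hZ]) (by simp [hZ]) (C.shape_restrict l)
  change (muMap (V := V.toWeakMulticatData) C.shape_φρ.whole (fun l => (lYW l).inv) (𝟙 g) ≫
      (assocIso C.shape_φρ oY oW g).hom) ≫
      muMap (V := V.toWeakMulticatData) C.shape_φρ.fst (fun j => 𝟙 (oY j))
        (muMap (V := V.toWeakMulticatData) C.shape_ψξ.whole (fun l => (lZW l).inv) (𝟙 g) ≫
          (assocIso C.shape_ψξ oZ oW g).hom) =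
    (muMap (V := V.toWeakMulticatData) C.shape_φρ.whole (fun l => (lZW l).inv) (𝟙 g) ≫
      (assocIso C.shape_χξ oZ oW g).hom) ≫
      muMap (V := V.toWeakMulticatData) C.shape_φψ.whole (fun k => (lYZ k).inv) (𝟙 G) ≫
        (assocIso C.shape_φψ oY oZ G).hom
  -- From the left: `e1` pulls the inner inverse unitor back across ν, `e3` rewrites the outer
  -- factor fibrewise and creates `κ`, the cube trades `κ` for the other pair of associators, and
  -- `e2` pushes the remaining inverse unitor forward.
  calc
    _ = muMap (V := V.toWeakMulticatData) C.shape_φρ.whole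
          (fun l => (lYW l).inv ≫ muMap (V := V.toWeakMulticatData) (C.shape_φρ.part l)
            (fun _ => 𝟙 (oY ((β.trans γ).symm l))) (lZW l).inv) (𝟙 g) ≫
        (assocIso C.shape_φρ oY ZW g).hom ≫
        muMap (V := V.toWeakMulticatData) C.shape_φρ.fst (fun j => 𝟙 (oY j))
          (assocIso C.shape_ψξ oZ oW g).hom := by
      rw [muMap_comp_right, muMap_comp_left]
      simp only [Category.assoc]
      rw [← Category.assoc (assocIso C.shape_φρ oY oW g).hom, ← e1]
      simp only [Category.assoc]
    _ = muMap (V := V.toWeakMulticatData) C.shape_φρ.whole (fun l => (lZW l).inv) (𝟙 g) ≫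
        muMap (V := V.toWeakMulticatData) C.shape_φρ.whole
          (fun l => muMap (V := V.toWeakMulticatData) (C.shape_χξ.part l)
            (fun _ => (lYZ (γ.symm l)).inv) (𝟙 (oW l))) (𝟙 g) ≫
        (assocIso C.shape_χξ YZ oW g).hom ≫ (assocIso C.shape_φψ oY oZ G).hom := by
      rw [cube, ← funext e3, muMap_comp_left, muMap_comp_left]
      simp only [Category.assoc]
    _ = _ := by
      rw [← Category.assoc _ (assocIso C.shape_χξ YZ oW g).hom, e2]
      simp only [Category.assoc]

theorem comparison_leftUnit (σ : Fin m ≃ Fin n) {X : Fin m → V.Ob} {Y : Fin n → V.Ob} {U : V.Ob}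
    (hX : ∀ i, X i = Y (σ i)) (h1 : ∀ i, X i = X ((1 : Equiv.Perm (Fin m)) i))
    (hσ : ∀ i, σ i = σ ((1 : Equiv.Perm (Fin m)) i)) (g : V.HomCat Y U) :
    (V.comparison 1 σ σ hσ h1 hX hX U).hom.app g ≫
      (V.rOne h1 U).hom.app ((V.r σ hX U).obj g) = 𝟙 _ := by
  have A : AssocShape (fun i : Fin m => i) σ σ (fun _ => 1) (fun k _ => σ.symm k)
      (fun _ => 1) (fun k _ => σ.symm k) (fun _ s => s) (fun i => [X i]) X (fun j => [Y j]) Y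
      (fun j => [Y j]) (List.ofFn X) (List.ofFn X) (List.ofFn Y) :=
    assocShape_equiv 1 σ σ hσ h1 hX
  let oY : ∀ j, V.Hom [Y j] (Y j) := fun j => V.one (Y j)
  change (muMap (V := V.toWeakMulticatData) A.whole
      (fun j => (leftUnitor (A.part j) (oY j)).inv) (𝟙 g) ≫
      (assocIso A (fun i => V.one (X i)) oY g).hom) ≫
      (leftUnitor A.fst (mu (V := V.toWeakMulticatData) A.snd oY g)).hom =
    𝟙 (mu (V := V.toWeakMulticatData) A.snd oY g)
  -- The left unit triangle leaves μ(`θ`, 1), the inverse of the first factor of the comparison.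
  rw [Category.assoc, ν_leftUnit σ A g, ← muMap_comp_left]
  simp only [oY, Iso.inv_hom_id]
  exact muMap_id _ _ _

theorem comparison_rightUnit (σ : Fin m ≃ Fin n) {X : Fin m → V.Ob} {Y : Fin n → V.Ob}
    {U : V.Ob} (hX : ∀ i, X i = Y (σ i)) (h1 : ∀ j, Y j = Y ((1 : Equiv.Perm (Fin n)) j))
    (hσ : ∀ i, σ i = (1 : Equiv.Perm (Fin n)) (σ i)) (g : V.HomCat Y U) :
    (V.comparison σ 1 σ hσ hX h1 hX U).hom.app g ≫
      (V.r σ hX U).map ((V.rOne h1 U).hom.app g) = 𝟙 _ := by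
  have A : AssocShape σ (fun j : Fin n => j) σ (fun _ => 1) (fun k _ => k)
      (fun _ => 1) (fun k _ => σ.symm k) (fun _ s => s) (fun j => [Y j]) Y (fun j => [Y j]) Y
      (fun j => [Y j]) (List.ofFn X) (List.ofFn Y) (List.ofFn Y) :=
    assocShape_equiv σ 1 σ hσ hX h1
  let oY : ∀ j, V.Hom [Y j] (Y j) := fun j => V.one (Y j)
  change (muMap (V := V.toWeakMulticatData) A.whole
      (fun j => (leftUnitor (A.part j) (oY j)).inv) (𝟙 g) ≫ (assocIso A oY oY g).hom) ≫
      muMap (V := V.toWeakMulticatData) A.fst (fun j => 𝟙 (oY j)) (leftUnitor A.snd g).hom =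
    𝟙 (mu (V := V.toWeakMulticatData) A.whole oY g)
  -- Axiom (ii) leaves `ζ` here, whereas the comparison contains the inverse of `θ`; they cancel
  -- because the two unitors agree on identities.
  rw [Category.assoc, ν_unit A oY g, ← muMap_comp_left]
  simp only [oY, ← θ_one_eq_rightUnitor, Iso.inv_hom_id]
  exact muMap_id _ _ _

end coherence

end SymmetricWeakMulticategory

/-! ### The proposition. -/

/-- The cocycle identity for the comparison isomorphisms, and the resulting weak action of the
symmetric group on the hom-categories `V((X i)_{i}; U)`, where `σ` takes `X` to `X ∘ σ`. -/
theorem proposition2p1p7 (V : SymmetricWeakMulticategory.{u, v, w}) :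
    (∀ {m n p q : ℕ} (α : Fin m ≃ Fin n) (β : Fin n ≃ Fin p) (γ : Fin p ≃ Fin q)
      (X : Fin m → V.Ob) (Y : Fin n → V.Ob) (Z : Fin p → V.Ob) (W : Fin q → V.Ob) (U : V.Ob)
      (hX : ∀ i, X i = Y (α i)) (hY : ∀ j, Y j = Z (β j)) (hZ : ∀ k, Z k = W (γ k)),
      (V.comparison α (β.trans γ) (α.trans (β.trans γ)) (fun _ => rfl) hX
            (fun j => (hY j).trans (hZ (β j)))
            (fun i => (hX i).trans ((hY (α i)).trans (hZ (β (α i))))) U).hom ≫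
          Functor.whiskerRight
            (V.comparison β γ (β.trans γ) (fun _ => rfl) hY hZ
              (fun j => (hY j).trans (hZ (β j))) U).hom (V.r α hX U) ≫
          (Functor.associator (V.r γ hZ U) (V.r β hY U) (V.r α hX U)).hom =
        (V.comparison (α.trans β) γ (α.trans (β.trans γ)) (fun _ => rfl)
            (fun i => (hX i).trans (hY (α i))) hZ
            (fun i => (hX i).trans ((hY (α i)).trans (hZ (β (α i))))) U).hom ≫
          Functor.whiskerLeft (V.r γ hZ U)
            (V.comparison α β (α.trans β) (fun _ => rfl) hX hY
              (fun i => (hX i).trans (hY (α i))) U).hom) ∧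
    (∀ (n : ℕ) (U : V.Ob),
      IsWeakAction (Equiv.Perm (Fin n)) (B := Fin n → V.Ob) (fun X σ => X ∘ σ)
        (fun X => V.HomCat X U)
        (fun σ _ _ h => V.r σ (fun i => congrFun h i) U)
        (fun σ τ ρ hρ _ _ _ h₁ h₂ h₃ =>
          V.comparison τ σ ρ (fun i => Equiv.congr_fun hρ i) (fun i => congrFun h₂ i)
            (fun i => congrFun h₁ i) (fun i => congrFun h₃ i) U)
        (fun h => V.rOne (fun i => congrFun h i) U)) := by
  refine ⟨?_, fun n U => ?_⟩
  · intro m n p q α β γ X Y Z W U hX hY hZ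
    ext g
    refine Eq.trans ?_ (SymmetricWeakMulticategory.comparison_cocycle α β γ (α.trans β)
      (β.trans γ) (α.trans (β.trans γ)) (fun _ => rfl) (fun _ => rfl)
      (fun _ => rfl) (fun _ => rfl) hX hY hZ _
      (fun j => (hY j).trans (hZ (β j))) _ g)
    -- The associator of functors has identity components.
    exact congrArg (_ ≫ ·) (Category.comp_id _)
  · exact
      { act_one := fun _ => rfl
        act_mul := fun _ _ _ => rfl
        -- The product `g * h` applies `h` first, so it is the left-to-right composite of `h` and
        -- `g`. The order of the three permutations is therefore reversed, the two sides of the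
        -- cocycle identity are swapped, and the left and right unit laws are exchanged.
        cocycle := fun g h k gh hk ghk e₁ e₂ e₃ e₄ b c d f hc hd hf hd' hf' hf'' w =>
          (SymmetricWeakMulticategory.comparison_cocycle k h g hk gh ghk
            (fun i => Equiv.congr_fun e₂ i) (fun i => Equiv.congr_fun e₁ i) (fun i => Equiv.congr_fun e₃ i)
            (fun i => Equiv.congr_fun e₄ i) (fun i => congrFun hf i) (fun i => congrFun hd i)
            (fun i => congrFun hc i) (fun i => congrFun hf' i) (fun i => congrFun hd' i)
            (fun i => congrFun hf'' i) w).symm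
        right_unit := fun g e _ _ hc h1 w => SymmetricWeakMulticategory.comparison_leftUnit g
          (fun i => congrFun hc i) (fun i => congrFun h1 i) (fun i => Equiv.congr_fun e i) w
        left_unit := fun g e _ _ hc h1 w => SymmetricWeakMulticategory.comparison_rightUnit g
          (fun i => congrFun hc i) (fun i => congrFun h1 i) (fun i => Equiv.congr_fun e i) w }
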